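/- Let $\Delta$ be a thick, locally finite building of type $\widetilde A_2$, with type function $\tau$ from its vertices to $\mathbb Z/3\mathbb Z$ such that each chamber has exactly one vertex of each type. Let $\Gamma$ be a torsion free $\widetilde A_2$ group acting on $\Delta$, i.e. a torsion free group of type rotating automorphisms of $\Delta$ (automorphisms $\alpha$ for which there is $i\in\mathbb Z/3\mathbb Z$ with $\tau(\alpha(v))=\tau(v)+i$ for all vertices $v$) which acts freely and transitively on the vertices of $\Delta$. Put $X=\Gamma\backslash\Delta$. Each edge of $\Delta$ is directed from its vertex of type $i$ to its vertex of type $i+1$; let $X^1$ be the set of $\Gamma$-orbits of directed edges. A directed chamber is a chamber with a chosen base vertex $v_0$; its other vertices are $v_1,v_2$, with $\tau(v_j)=\tau(v_0)+j$. Let $\widehat X^2$ be the (finite) set of $\Gamma$-orbits of directed chambers, the directed 2-cells of $X$. For $a\in\widehat X^2$ represented by $(v_0,v_1,v_2)$ write $a=\langle a_0,a_1,a_2\rangle$, where $a_0,a_1,a_2\in X^1$ are the orbits of the edges $v_1\to v_2$, $v_2\to v_0$, $v_0\to v_1$. The cells obtained from $a$ by changing the base vertex to $v_1$ and $v_2$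 are $\langle a_1,a_2,a_0\rangle$ and $\langle a_2,a_0,a_1\rangle$. For $a,b\in\widehat X^2$ put $m_{ab}=1$ if $a,b$ have representatives $(v_0,v_1,v_2)$ and $(v_1,w_1,w_2)$ such that $\{v_1,v_2,w_2\}$ is a chamber and $\{v_1,v_0,w_1\}$ is not, and $m_{ab}=0$ otherwise. Put $n_{ab}=1$ if $a,b$ have representatives $(v_0,v_1,v_2)$ and $(v_2,w_1,w_2)$ such that $\{v_2,v_1,w_1\}$ is a chamber and $\{v_2,v_0,w_2\}$ is not, and $n_{ab}=0$ otherwise. Let $C(\Gamma)$ be the abelian group with generating set $\widehat X^2$ and relations $$a=\sum_{b\in\widehat X^2}m_{ab}\,b=\sum_{b\in\widehat X^2}n_{ab}\,b,\qquad a\in\widehat X^2 .$$ A harmonic 2-cochain is a function $c:\widehat X^2\to\mathbb R$ such that for all $\langle a_0,a_1,a_2\rangle\in\widehat X^2$ and all $\xi\in X^1$ $$c(\langle a_0,a_1,a_2\rangle)=c(\langle a_1,a_2,a_0\rangle)=c(\langle a_2,a_0,a_1\rangle),\qquad \sum_{a_2=\xi}c(a)=0=\sum_{a_1=\xi}c(a),$$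 the sums being over the $a\in\widehat X^2$ with $a_2=\xi$, respectively $a_1=\xi$. Let $C^2_{har}(\widehat X^2)$ be the real vector space of harmonic 2-cochains. Then $C^2_{har}(\widehat X^2)$ and $C(\Gamma)\otimes\mathbb R$ are isomorphic as real vector spaces. -/

import Mathlib

open scoped TensorProduct

namespace A2Tilde

/-- The 1-skeleton of the triangulation of the Euclidean plane by equilateral triangles: the
triangular lattice, in coordinates for which `e₁ = (1, 0)`, `e₂ = (0, 1)`, `e₃ = (-1, -1)` are the
three vectors at mutual angle `2π/3`; the six neighbours of `x` are `x ± eᵢ`. -/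
def triangularLattice : SimpleGraph (ℤ × ℤ) where
  Adj x y := y - x ∈ ({(1, 0), (0, 1), (-1, -1), (-1, 0), (0, -1), (1, 1)} : Set (ℤ × ℤ))
  symm := ⟨by
    rintro ⟨a, b⟩ ⟨c, d⟩ h
    simp only [Prod.mk_sub_mk, Set.mem_insert_iff, Set.mem_singleton_iff, Prod.mk.injEq] at h ⊢
    omega⟩
  loopless := ⟨by
    rintro ⟨a, b⟩ h
    simp only [Prod.mk_sub_mk, Set.mem_insert_iff, Set.mem_singleton_iff, Prod.mk.injEq] at h
    omega⟩

/-- The Coxeter complex of type `Ã₂`: the plane triangulated by equilateral triangles. Its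
simplices are the vertices, edges and triangles of the triangular lattice, i.e. the nonempty finite
sets of pairwise adjacent lattice points. -/
def coxeterComplex : AbstractSimplicialComplex (ℤ × ℤ) where
  faces := {s | s.Nonempty ∧ triangularLattice.IsClique (s : Set (ℤ × ℤ))}
  isRelLowerSet_faces := by
    intro s hs
    refine ⟨hs.1, fun t hts ht => ⟨ht, ?_⟩⟩
    exact hs.2.subset (Finset.coe_subset.2 hts)
  singleton_mem := by
    intro v
    simp [SimpleGraph.IsClique]

open scoped Classical in
/-- `K` is a building of type `Ã₂`: there is a family of subcomplexes (apartments) such that every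
apartment is isomorphic to the Coxeter complex of type `Ã₂`, any two simplices lie in a common
apartment, and for two apartments `A`, `A'` that both contain the simplices `s` and `t` there is
an isomorphism `A → A'` (given by the vertex map `φ`) that fixes `s` and `t` pointwise. -/
def IsBuilding {V : Type*} (K : AbstractSimplicialComplex V) : Prop :=
  ∃ 𝒜 : Set (PreAbstractSimplicialComplex V),
    (∀ A ∈ 𝒜, A ≤ K.toPreAbstractSimplicialComplex) ∧
    (∀ A ∈ 𝒜, ∃ f : ℤ × ℤ → V, Function.Injective f ∧
      A = coxeterComplex.toPreAbstractSimplicialComplex.map f) ∧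
    (∀ s ∈ K.faces, ∀ t ∈ K.faces, ∃ A ∈ 𝒜, s ∈ A.faces ∧ t ∈ A.faces) ∧
    (∀ A ∈ 𝒜, ∀ A' ∈ 𝒜, ∀ s t : Finset V,
      s ∈ A.faces → t ∈ A.faces → s ∈ A'.faces → t ∈ A'.faces →
      ∃ φ : V → V, Set.InjOn φ {v | {v} ∈ A.faces} ∧ A.map φ = A' ∧
        (∀ v ∈ s, φ v = v) ∧ (∀ v ∈ t, φ v = v))

/-- A (thick) locally finite building of type `Ã₂` with vertex set `V`, with a type function on the
vertices, for which each chamber has exactly one vertex of each type. -/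
structure Building (V : Type*) where
  /-- the underlying simplicial complex -/
  complex : AbstractSimplicialComplex V
  /-- the type of a vertex -/
  vtype : V → ZMod 3
  nonempty : Nonempty V
  isBuilding : IsBuilding complex
  locallyFinite : ∀ v : V, {s | s ∈ complex.faces ∧ v ∈ s}.Finite
  /-- each edge is contained in at least three chambers -/
  thick : ∀ e ∈ complex.faces, e.card = 2 →
    3 ≤ {s | s ∈ complex.faces ∧ s.card = 3 ∧ e ⊆ s}.ncard
  existsUnique_vtype : ∀ s ∈ complex.faces, s.card = 3 → ∀ i : ZMod 3, ∃! v, v ∈ s ∧ vtype v = i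

variable {V : Type*}

open scoped Classical in
/-- `Γ` acts on the building `B` as an `Ã₂` group: by type rotating automorphisms, freely and
transitively on the vertices (so that `Γ` is a group of automorphisms of `B`). -/
class IsA2TildeGroup (Γ : Type*) [Group Γ] [MulAction Γ V] (B : Building V) : Prop where
  image_mem : ∀ (g : Γ), ∀ s ∈ B.complex.faces, s.image (fun v => g • v) ∈ B.complex.faces
  type_rotating : ∀ g : Γ, ∃ i : ZMod 3, ∀ v : V, B.vtype (g • v) = B.vtype v + i
  free : ∀ (g : Γ) (v : V), g • v = v → g = 1
  transitive : ∀ v w : V, ∃ g : Γ, g • v = w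

namespace Building

open scoped Classical in
/-- A directed edge `src → tgt`: from a vertex of type `i` to an adjacent vertex of type
`i + 1`. -/
@[ext] structure DirectedEdge (B : Building V) where
  src : V
  tgt : V
  mem : {src, tgt} ∈ B.complex.faces
  vtype_tgt : B.vtype tgt = B.vtype src + 1

open scoped Classical in
/-- A directed 2-simplex: a chamber with a specified base vertex `v₀`. The other two vertices are
named by their types: if `v₀` has type `i`, then `v₁` has type `i + 1` and `v₂` has type `i + 2`.
Hence the directed edges of the chamber are `v₀ → v₁`, `v₁ → v₂` and `v₂ → v₀`. -/
@[ext] structure DirectedChamber (B : Building V) where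
  v₀ : V
  v₁ : V
  v₂ : V
  mem : {v₀, v₁, v₂} ∈ B.complex.faces
  vtype_v₁ : B.vtype v₁ = B.vtype v₀ + 1
  vtype_v₂ : B.vtype v₂ = B.vtype v₀ + 2

open scoped Classical in
/-- A directed chamber is the same as a chamber together with one of its vertices. -/
theorem existsUnique_directedChamber (B : Building V) (s : Finset V) (hs : s ∈ B.complex.faces)
    (hc : s.card = 3) (v : V) (hv : v ∈ s) :
    ∃! a : B.DirectedChamber, a.v₀ = v ∧ ({a.v₀, a.v₁, a.v₂} : Finset V) = s := by
  obtain ⟨x, ⟨hx, hxt⟩, hxu⟩ := B.existsUnique_vtype s hs hc (B.vtype v + 1)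
  obtain ⟨y, ⟨hy, hyt⟩, hyu⟩ := B.existsUnique_vtype s hs hc (B.vtype v + 2)
  have hvx : v ≠ x := by
    rintro rfl
    have h2 := left_eq_add.1 hxt
    revert h2; decide
  have hvy : v ≠ y := by
    rintro rfl
    have h2 := left_eq_add.1 hyt
    revert h2; decide
  have hxy : x ≠ y := by
    rintro rfl
    have h2 := add_left_cancel (hxt.symm.trans hyt)
    revert h2; decide
  have hset : ({v, x, y} : Finset V) = s := by
    apply Finset.eq_of_subset_of_card_le
    · intro z hz
      simp only [Finset.mem_insert, Finset.mem_singleton] at hz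
      rcases hz with rfl | rfl | rfl <;> assumption
    · rw [hc, Finset.card_eq_three.2 ⟨v, x, y, hvx, hvy, hxy, rfl⟩]
  refine ⟨⟨v, x, y, by rw [hset]; exact hs, hxt, hyt⟩, ⟨rfl, hset⟩, ?_⟩
  rintro ⟨a, b, c, h1, h2, h3⟩ ⟨h4, h5⟩
  simp only at h4 h5
  subst h4
  have hb : b = x := hxu b ⟨by rw [← h5]; simp, h2⟩
  have hc' : c = y := hyu c ⟨by rw [← h5]; simp, h3⟩
  subst hb hc'
  rfl

namespace DirectedChamber

variable {B : Building V}

theorem face_ne (a : B.DirectedChamber) : a.v₀ ≠ a.v₁ ∧ a.v₁ ≠ a.v₂ ∧ a.v₂ ≠ a.v₀ := by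
  have h1 := a.vtype_v₁
  have h2 := a.vtype_v₂
  refine ⟨fun h => ?_, fun h => ?_, fun h => ?_⟩
  · rw [← h] at h1
    have h3 := left_eq_add.1 h1
    revert h3; decide
  · rw [h] at h1
    have h3 := add_left_cancel (h1.symm.trans h2)
    revert h3; decide
  · rw [h] at h2
    have h3 := left_eq_add.1 h2
    revert h3; decide

/-- Cyclic permutation of the base vertex: the base vertex `v₀` is replaced by `v₁`. -/
def rotate (a : B.DirectedChamber) : B.DirectedChamber where
  v₀ := a.v₁
  v₁ := a.v₂
  v₂ := a.v₀
  mem := by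
    have h := a.mem
    convert h using 1
    ext z
    simp only [Finset.mem_insert, Finset.mem_singleton]
    tauto
  vtype_v₁ := by
    rw [a.vtype_v₂, a.vtype_v₁, add_assoc]; rfl
  vtype_v₂ := by
    have h3 : (1 : ZMod 3) + 2 = 0 := by decide
    rw [a.vtype_v₁, add_assoc, h3, add_zero]

/-- The edge `a₀` of a directed chamber, opposite to the base vertex: `v₁ → v₂`. -/
def edge₀ (a : B.DirectedChamber) : B.DirectedEdge where
  src := a.v₁
  tgt := a.v₂
  mem := (B.complex.isRelLowerSet_faces a.mem).2
    (fun z hz => by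
      simp only [Finset.mem_insert, Finset.mem_singleton] at hz ⊢
      tauto) ⟨a.v₁, by simp⟩
  vtype_tgt := a.rotate.vtype_v₁

/-- The edge `a₁` of a directed chamber, ending at the base vertex: `v₂ → v₀`. -/
def edge₁ (a : B.DirectedChamber) : B.DirectedEdge := a.rotate.edge₀

/-- The edge `a₂` of a directed chamber, starting at the base vertex: `v₀ → v₁`. -/
def edge₂ (a : B.DirectedChamber) : B.DirectedEdge := a.rotate.rotate.edge₀

end DirectedChamber

section Quotient

variable (Γ : Type*) [Group Γ] [MulAction Γ V] (B : Building V)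

/-- Two directed edges are equivalent if they are in the same orbit of `Γ`. -/
def edgeSetoid : Setoid B.DirectedEdge :=
  (MulAction.orbitRel Γ (V × V)).comap fun e => (e.src, e.tgt)

/-- Two directed chambers are equivalent if they are in the same orbit of `Γ`. -/
def chamberSetoid : Setoid B.DirectedChamber :=
  (MulAction.orbitRel Γ (V × V × V)).comap fun a => (a.v₀, a.v₁, a.v₂)

/-- The set `X¹` of 1-cells of `X = Γ \ Δ`. -/
def Edge : Type _ := Quotient (edgeSetoid Γ B)

/-- The set of directed 2-cells of `X = Γ \ Δ`. -/
def Cell : Type _ := Quotient (chamberSetoid Γ B)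

variable {B}

/-- The 1-cell of `X` represented by a directed edge of the building. -/
def DirectedEdge.toEdge (e : B.DirectedEdge) : Edge Γ B := Quotient.mk (edgeSetoid Γ B) e

/-- The directed 2-cell of `X` represented by a directed chamber of the building. -/
def DirectedChamber.toCell (a : B.DirectedChamber) : Cell Γ B :=
  Quotient.mk (chamberSetoid Γ B) a

theorem DirectedChamber.rel_iff {a b : B.DirectedChamber} :
    chamberSetoid Γ B a b ↔ ∃ g : Γ, g • b.v₀ = a.v₀ ∧ g • b.v₁ = a.v₁ ∧ g • b.v₂ = a.v₂ := by
  change (a.v₀, a.v₁, a.v₂) ∈ MulAction.orbit Γ (b.v₀, b.v₁, b.v₂) ↔ _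
  simp [MulAction.mem_orbit_iff]

theorem DirectedEdge.rel_iff {e f : B.DirectedEdge} :
    edgeSetoid Γ B e f ↔ ∃ g : Γ, g • f.src = e.src ∧ g • f.tgt = e.tgt := by
  change (e.src, e.tgt) ∈ MulAction.orbit Γ (f.src, f.tgt) ↔ _
  simp [MulAction.mem_orbit_iff]

variable {Γ}

namespace Cell

/-- Cyclic permutation `⟨a₀, a₁, a₂⟩ ↦ ⟨a₁, a₂, a₀⟩` of a directed 2-cell. -/
def rotate : Cell Γ B → Cell Γ B :=
  Quotient.map DirectedChamber.rotate fun a b h => by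
    obtain ⟨g, h0, h1, h2⟩ := (DirectedChamber.rel_iff Γ).1 h
    exact (DirectedChamber.rel_iff Γ).2 ⟨g, h1, h2, h0⟩

/-- The label `a₀` of a directed 2-cell `a = ⟨a₀, a₁, a₂⟩`. -/
def edge₀ : Cell Γ B → Edge Γ B :=
  Quotient.map DirectedChamber.edge₀ fun a b h => by
    obtain ⟨g, h0, h1, h2⟩ := (DirectedChamber.rel_iff Γ).1 h
    exact (DirectedEdge.rel_iff Γ).2 ⟨g, h1, h2⟩

/-- The label `a₁` of a directed 2-cell `a = ⟨a₀, a₁, a₂⟩`. -/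
def edge₁ (a : Cell Γ B) : Edge Γ B := a.rotate.edge₀

/-- The label `a₂` of a directed 2-cell `a = ⟨a₀, a₁, a₂⟩`. -/
def edge₂ (a : Cell Γ B) : Edge Γ B := a.rotate.rotate.edge₀

end Cell

variable (Γ B)

/-- There are only finitely many directed 2-cells. -/
theorem finite_cell [IsA2TildeGroup Γ B] : Finite (Cell Γ B) := by
  classical
  obtain ⟨x⟩ := B.nonempty
  have hU : (⋃ s ∈ {s | s ∈ B.complex.faces ∧ x ∈ s}, (s : Set V)).Finite :=
    (B.locallyFinite x).biUnion fun s _ => s.finite_toSet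
  set U := ⋃ s ∈ {s | s ∈ B.complex.faces ∧ x ∈ s}, (s : Set V) with hUdef
  have : Finite {a : B.DirectedChamber // a.v₀ = x} := by
    have := hU.to_subtype
    have hmem : ∀ a : {a : B.DirectedChamber // a.v₀ = x},
        ∀ z ∈ ({a.1.v₀, a.1.v₁, a.1.v₂} : Finset V), z ∈ U := by
      intro a z hz
      refine Set.mem_biUnion (x := ({a.1.v₀, a.1.v₁, a.1.v₂} : Finset V)) ⟨a.1.mem, ?_⟩ hz
      simp [a.2]
    refine Finite.of_injective
      (fun a : {a : B.DirectedChamber // a.v₀ = x} =>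
        ((⟨a.1.v₁, hmem a _ (by simp)⟩, ⟨a.1.v₂, hmem a _ (by simp)⟩) : U × U)) ?_
    rintro ⟨a, ha⟩ ⟨b, hb⟩ hab
    simp only [Prod.mk.injEq, Subtype.mk.injEq] at hab
    exact Subtype.ext (DirectedChamber.ext (ha.trans hb.symm) hab.1 hab.2)
  refine Finite.of_surjective
    (fun a : {a : B.DirectedChamber // a.v₀ = x} => a.1.toCell Γ) ?_
  intro c
  obtain ⟨a, rfl⟩ := Quotient.exists_rep c
  obtain ⟨g, hg⟩ := IsA2TildeGroup.transitive B (Γ := Γ) a.v₀ x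
  obtain ⟨i, hi⟩ := IsA2TildeGroup.type_rotating (B := B) g
  refine ⟨⟨⟨g • a.v₀, g • a.v₁, g • a.v₂, ?_, ?_, ?_⟩, hg⟩, ?_⟩
  · have h := IsA2TildeGroup.image_mem g _ a.mem
    simpa [Finset.image_insert] using h
  · rw [hi, hi, a.vtype_v₁]; ring
  · rw [hi, hi, a.vtype_v₂]; ring
  · exact Quotient.sound ((DirectedChamber.rel_iff Γ).2 ⟨g, rfl, rfl, rfl⟩)

noncomputable instance [IsA2TildeGroup Γ B] : Fintype (Cell Γ B) :=
  have := finite_cell Γ B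
  Fintype.ofFinite _

variable {Γ B}

open scoped Classical in
/-- The relation `m_{ab} = 1`: there are representatives `α` of `a` and `β` of `b` in the building
such that `β` is based at the vertex `α₁` (the top right vertex of `α`), the vertices
`α₁, α₂, β₂` form a chamber, and `β₁` is not incident with `α₀` in the link of `α₁`. (Seen in the
link of `α₁`, with points the vertices of the next type and lines those of the previous type: the
point `β₁` is not on the line `α₀`, and `β₂` is the line through the points `α₂` and `β₁`.) -/
def RelM (a b : Cell Γ B) : Prop :=
  ∃ α β : B.DirectedChamber, α.toCell Γ = a ∧ β.toCell Γ = b ∧ β.v₀ = α.v₁ ∧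
    {α.v₁, α.v₂, β.v₂} ∈ B.complex.faces ∧ {α.v₁, α.v₀, β.v₁} ∉ B.complex.faces

open scoped Classical in
/-- The relation `n_{ac} = 1`: there are representatives `α` of `a` and `γ` of `c` in the building
such that `γ` is based at the vertex `α₂` (the top left vertex of `α`), the vertices
`α₂, α₁, γ₁` form a chamber, and `γ₂` is not incident with `α₀` in the link of `α₂`. (Seen in the
link of `α₂`: the point `α₀` is not on the line `γ₂`, and `γ₁` is the common point of the lines
`α₁` and `γ₂`.) -/
def RelN (a c : Cell Γ B) : Prop :=
  ∃ α γ : B.DirectedChamber, α.toCell Γ = a ∧ γ.toCell Γ = c ∧ γ.v₀ = α.v₂ ∧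
    {α.v₂, α.v₁, γ.v₁} ∈ B.complex.faces ∧ {α.v₂, α.v₀, γ.v₂} ∉ B.complex.faces

variable (Γ B)

open scoped Classical in
/-- The transition matrix `M = (m_{ab})`. -/
noncomputable def matM : Matrix (Cell Γ B) (Cell Γ B) ℤ :=
  Matrix.of fun a b => if RelM a b then 1 else 0

open scoped Classical in
/-- The transition matrix `N = (n_{ab})`. -/
noncomputable def matN : Matrix (Cell Γ B) (Cell Γ B) ℤ :=
  Matrix.of fun a b => if RelN a b then 1 else 0

/-- The subgroup of the free abelian group on the directed 2-cells generated by the relators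
`a - ∑ b, m_{ab} b` and `a - ∑ b, n_{ab} b`. -/
noncomputable def relators [IsA2TildeGroup Γ B] : AddSubgroup (Cell Γ B →₀ ℤ) :=
  AddSubgroup.closure
    (Set.range (fun a : Cell Γ B =>
        Finsupp.single a 1 - ∑ b, matM Γ B a b • Finsupp.single b (1 : ℤ)) ∪
      Set.range (fun a : Cell Γ B =>
        Finsupp.single a 1 - ∑ b, matN Γ B a b • Finsupp.single b (1 : ℤ)))

/-- The abelian group `C(Γ)` with the directed 2-cells as generators and the relations
`a = ∑ b, m_{ab} b = ∑ b, n_{ab} b`. -/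
abbrev CGroup [IsA2TildeGroup Γ B] : Type _ := (Cell Γ B →₀ ℤ) ⧸ relators Γ B

open scoped Classical in
/-- The real vector space of harmonic 2-cochains: functions `c` on the directed 2-cells that are
invariant under cyclic permutation and for which, for every 1-cell `ξ`, the sum of `c` over the
cells `a` with `a₂ = ξ` (the value on `⟨ξ⟩`) and the sum over the cells `a` with `a₁ = ξ` (the
value on `⟨ξ̄⟩`) are zero. -/
noncomputable def harmonicCochains [IsA2TildeGroup Γ B] : Submodule ℝ (Cell Γ B → ℝ) where
  carrier := {c | (∀ a : Cell Γ B, c a = c a.rotate ∧ c a = c a.rotate.rotate) ∧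
    ∀ ξ : Edge Γ B, ∑ a with Cell.edge₂ a = ξ, c a = 0 ∧ ∑ a with Cell.edge₁ a = ξ, c a = 0}
  zero_mem' := by simp
  add_mem' := by
    rintro c d ⟨hc, hc'⟩ ⟨hd, hd'⟩
    refine ⟨fun a => ⟨?_, ?_⟩, fun ξ => ⟨?_, ?_⟩⟩
    · simp only [Pi.add_apply, ← (hc a).1, ← (hd a).1]
    · simp only [Pi.add_apply, ← (hc a).2, ← (hd a).2]
    · simp only [Pi.add_apply, Finset.sum_add_distrib, (hc' ξ).1, (hd' ξ).1, add_zero]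
    · simp only [Pi.add_apply, Finset.sum_add_distrib, (hc' ξ).2, (hd' ξ).2, add_zero]
  smul_mem' := by
    rintro r c ⟨hc, hc'⟩
    refine ⟨fun a => ⟨?_, ?_⟩, fun ξ => ⟨?_, ?_⟩⟩
    · simp only [Pi.smul_apply, ← (hc a).1]
    · simp only [Pi.smul_apply, ← (hc a).2]
    · simp only [Pi.smul_apply, ← Finset.smul_sum, (hc' ξ).1, smul_zero]
    · simp only [Pi.smul_apply, ← Finset.smul_sum, (hc' ξ).2, smul_zero]

end Quotient

end Building

end A2Tilde

/-! For a labelling `e` of the cells let S be the operator summing a function over the fibres of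
`e`, and P = S - 1 (`panelOp`). With `e` one of the two edges at the base vertex, P sums over the
other cells on that edge. The relation defining M says that b is reached from the rotated cell a by
changing the third and then the second vertex, both steps being proper; N exchanges the two steps
and starts from the doubly rotated cell (`relM_iff`, `relN_iff`). This rests on the link of a vertex
having no 4-cycle. So M and N are products of two panel operators followed by a rotation
(`sum_matM_mul`, `sum_matN_mul`).

On a harmonic cochain each P is -1 and rotation is trivial, so M and N fix it. Conversely, on a
fibre with k elements P is k - 1 on constants and -1 on functions of sum zero. Thickness gives k ≥
3, so P never decreases the ℓ² norm and preserves it only when all fibre sums vanish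
(`sum_sq_panelOp`). Rotation is an isometry, so a vector fixed by M has vanishing fibre sums and is
then rotation invariant: it is harmonic (`mem_harmonicCochains_iff_fixed`).

Common fixed vectors of M and N are the homomorphisms C(Γ) → ℝ, that is, the dual of ℝ ⊗ C(Γ). This
space is finite dimensional, hence isomorphic to its dual. -/

namespace A2Tilde

/-! ### Apartments and links of vertices -/

open scoped Classical in
/-- In a building, an apartment containing the simplices `s` and `t` contains `s ∪ t` as soon as
`s ∪ t` is a simplex. -/
theorem union_mem_apartment {V : Type*} {K : AbstractSimplicialComplex V}
    {𝒜 : Set (PreAbstractSimplicialComplex V)}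
    (hpair : ∀ s ∈ K.faces, ∀ t ∈ K.faces, ∃ A ∈ 𝒜, s ∈ A.faces ∧ t ∈ A.faces)
    (hiso : ∀ A ∈ 𝒜, ∀ A' ∈ 𝒜, ∀ s t : Finset V,
      s ∈ A.faces → t ∈ A.faces → s ∈ A'.faces → t ∈ A'.faces →
      ∃ φ : V → V, Set.InjOn φ {v | {v} ∈ A.faces} ∧ A.map φ = A' ∧
        (∀ v ∈ s, φ v = v) ∧ (∀ v ∈ t, φ v = v))
    {A : PreAbstractSimplicialComplex V} (hA : A ∈ 𝒜) {s t : Finset V}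
    (hs : s ∈ A.faces) (ht : t ∈ A.faces) (hst : s ∪ t ∈ K.faces) : s ∪ t ∈ A.faces := by
  obtain ⟨A', hA', hst', -⟩ := hpair _ hst _ hst
  have hsub := (A'.isRelLowerSet_faces hst').2
  obtain ⟨φ, hinj, hmap, hφs, hφt⟩ := hiso A hA A' hA' s t hs ht
    (hsub Finset.subset_union_left (A.isRelLowerSet_faces hs).1)
    (hsub Finset.subset_union_right (A.isRelLowerSet_faces ht).1)
  have hfix : ∀ z ∈ s ∪ t, φ z = z := fun z hz =>
    (Finset.mem_union.1 hz).elim (hφs z) (hφt z)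
  have hvert : ∀ r ∈ A.faces, ∀ z ∈ r, {z} ∈ A.faces := fun r hr z hz =>
    (A.isRelLowerSet_faces hr).2 (Finset.singleton_subset_iff.2 hz) (Finset.singleton_nonempty z)
  have hvert' : ∀ z ∈ s ∪ t, {z} ∈ A.faces := fun z hz =>
    (Finset.mem_union.1 hz).elim (hvert s hs z) (hvert t ht z)
  rw [← hmap] at hst'
  obtain ⟨r, hr, hrst⟩ := hst'
  have hrst : r.image φ = s ∪ t := hrst
  -- `φ y` lies in `s ∪ t`, so `φ` fixes it; thus `y` and `φ y` are vertices of `A` with the same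
  -- image, and injectivity applies.
  have key : ∀ y ∈ r, φ y = y := fun y hy => by
    have hy' : φ y ∈ s ∪ t := hrst ▸ Finset.mem_image_of_mem φ hy
    exact hinj (hvert' _ hy') (hvert r hr y hy) (hfix _ hy')
  have : r.image φ = r := by
    rw [Finset.image_congr (g := id) (fun y hy => key y hy), Finset.image_id]
  rw [← hrst, this]
  exact hr

/-- The link of a vertex of the triangular lattice is a hexagon and contains no 4-cycle. -/
theorem triangularLattice_link {x a a' b b' : ℤ × ℤ}
    (ha : triangularLattice.Adj x a) (ha' : triangularLattice.Adj x a')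
    (hb : triangularLattice.Adj x b) (hb' : triangularLattice.Adj x b')
    (hab : triangularLattice.Adj a b) (hab' : triangularLattice.Adj a b')
    (ha'b : triangularLattice.Adj a' b) (ha'b' : triangularLattice.Adj a' b')
    (h : a ≠ a') : b = b' := by
  obtain ⟨x1, x2⟩ := x
  obtain ⟨a1, a2⟩ := a
  obtain ⟨c1, c2⟩ := a'
  obtain ⟨b1, b2⟩ := b
  obtain ⟨d1, d2⟩ := b'
  simp only [triangularLattice, Prod.mk_sub_mk, Set.mem_insert_iff, Set.mem_singleton_iff,
    Prod.mk.injEq, ne_eq] at *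
  -- Two distinct vertices of a hexagon have at most one common neighbour in it; the positions of
  -- `a` and `a'` around `x` are enumerated.
  rcases ha with ha | ha | ha | ha | ha | ha <;> rcases ha' with ha' | ha' | ha' | ha' | ha' | ha' <;>
    omega

open scoped Classical in
/-- In a building of type `Ã₂`, the link of a vertex contains no 4-cycle. -/
theorem IsBuilding.link {V : Type*} {K : AbstractSimplicialComplex V} (hK : IsBuilding K)
    {v p p' l l' : V} (hvp : v ≠ p) (hvp' : v ≠ p') (hvl : v ≠ l) (hvl' : v ≠ l')
    (hpl : p ≠ l) (hpl' : p ≠ l') (hp'l : p' ≠ l) (hp'l' : p' ≠ l')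
    (h₁ : {v, p, l} ∈ K.faces) (h₂ : {v, p, l'} ∈ K.faces)
    (h₃ : {v, p', l} ∈ K.faces) (h₄ : {v, p', l'} ∈ K.faces) (hp : p ≠ p') : l = l' := by
  obtain ⟨𝒜, -, hcox, hpair, hiso⟩ := hK
  -- An apartment through two opposite sides of the 4-cycle contains all its vertices, hence also
  -- the other two sides by `union_mem_apartment`.
  obtain ⟨A, hA, hA₁, hA₄⟩ := hpair _ h₁ _ h₄
  have hsub : ∀ {s t : Finset V}, s ∈ A.faces → t ⊆ s → t.Nonempty → t ∈ A.faces :=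
    fun hs ht hn => (A.isRelLowerSet_faces hs).2 ht hn
  have hA₂ : {v, p} ∪ {v, l'} ∈ A.faces := by
    refine union_mem_apartment hpair hiso hA (hsub hA₁ ?_ (by simp)) (hsub hA₄ ?_ (by simp)) ?_
    · intro z; simp; tauto
    · intro z; simp; tauto
    · convert h₂ using 1; ext z; simp
  have hA₃ : {v, p'} ∪ {v, l} ∈ A.faces := by
    refine union_mem_apartment hpair hiso hA (hsub hA₄ ?_ (by simp)) (hsub hA₁ ?_ (by simp)) ?_
    · intro z; simp; tauto
    · intro z; simp; tauto
    · convert h₃ using 1; ext z; simp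
  obtain ⟨f, hf, rfl⟩ := hcox A hA
  have hadj : ∀ s ∈ (coxeterComplex.toPreAbstractSimplicialComplex.map f).faces, ∀ x y : ℤ × ℤ,
      f x ∈ s → f y ∈ s → f x ≠ f y → triangularLattice.Adj x y := by
    rintro _ ⟨r, hr, rfl⟩ x y hx hy hxy
    obtain ⟨x', hx', hxx⟩ := Finset.mem_image.1 hx
    obtain ⟨y', hy', hyy⟩ := Finset.mem_image.1 hy
    rw [hf hxx] at hx'
    rw [hf hyy] at hy'
    exact hr.2 hx' hy' fun h => hxy (congrArg f h)
  have hpre : ∀ s ∈ (coxeterComplex.toPreAbstractSimplicialComplex.map f).faces, ∀ z ∈ s,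
      ∃ x, f x = z := by
    rintro _ ⟨r, hr, rfl⟩ z hz
    obtain ⟨x, -, hx⟩ := Finset.mem_image.1 hz
    exact ⟨x, hx⟩
  obtain ⟨x, rfl⟩ := hpre _ hA₁ v (by simp)
  obtain ⟨a, rfl⟩ := hpre _ hA₁ p (by simp)
  obtain ⟨b, rfl⟩ := hpre _ hA₁ l (by simp)
  obtain ⟨a', rfl⟩ := hpre _ hA₄ p' (by simp)
  obtain ⟨b', rfl⟩ := hpre _ hA₄ l' (by simp)
  refine congrArg f (triangularLattice_link (x := x) (a := a) (a' := a')
    (hadj _ hA₁ _ _ (by simp) (by simp) hvp) (hadj _ hA₄ _ _ (by simp) (by simp) hvp')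
    (hadj _ hA₁ _ _ (by simp) (by simp) hvl) (hadj _ hA₄ _ _ (by simp) (by simp) hvl')
    (hadj _ hA₁ _ _ (by simp) (by simp) hpl) (hadj _ hA₂ _ _ (by simp) (by simp) hpl')
    (hadj _ hA₃ _ _ (by simp) (by simp) hp'l) (hadj _ hA₄ _ _ (by simp) (by simp) hp'l')
    fun h => hp (congrArg f h))

/-! ### Panel operators and the norm estimate -/

section Panel

variable {α β : Type*} [Fintype α]

open scoped Classical in
/-- The sum of `c` over the fibre of `e` through `a`. -/
noncomputable def fiberSum (e : α → β) (c : α → ℝ) (a : α) : ℝ := ∑ b with e b = e a, c b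

/-- The sum of `c` over the elements other than `a` of the fibre of `e` through `a`. -/
noncomputable def panelOp (e : α → β) (c : α → ℝ) (a : α) : ℝ := fiberSum e c a - c a

theorem fiberSum_congr (e : α → β) (c : α → ℝ) {a b : α} (h : e a = e b) :
    fiberSum e c a = fiberSum e c b := by
  rw [fiberSum, fiberSum, h]

open scoped Classical in
theorem panelOp_eq_sum (e : α → β) (c : α → ℝ) (a : α) :
    panelOp e c a = ∑ b with e b = e a ∧ b ≠ a, c b := by
  rw [panelOp, fiberSum, sub_eq_iff_eq_add, Finset.filter_and_not, add_comm,
    ← Finset.sum_sdiff (s₁ := {a}) (s₂ := Finset.univ.filter fun b => e b = e a) (by simp),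
    Finset.sum_singleton, add_comm]
  congr 2
  ext b
  simp

open scoped Classical in
/-- The composition of two panel operators, if each point is determined by its two fibres. -/
theorem panelOp_panelOp_eq_sum {β' : Type*} (e : α → β) (e' : α → β')
    (hinj : ∀ d d', e d = e d' → e' d = e' d' → d = d') (c : α → ℝ) (a : α) :
    panelOp e (panelOp e' c) a
      = ∑ b with ∃ d, (e d = e a ∧ d ≠ a) ∧ e' b = e' d ∧ b ≠ d, c b := by
  rw [panelOp_eq_sum]
  simp only [panelOp_eq_sum e']
  rw [← Finset.sum_biUnion]
  · refine Finset.sum_congr ?_ fun _ _ => rfl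
    ext b
    simp
  -- The intermediate point is unique: it lies in the `e`-fibre of `a` and in the `e'`-fibre of `b`.
  -- So every `b` is counted once.
  · intro d hd d' hd' hne
    refine Finset.disjoint_left.2 fun b hb hb' => hne ?_
    simp only [Finset.coe_filter, Finset.mem_univ, true_and, Set.mem_ofPred_eq,
      Finset.mem_filter] at hd hd' hb hb'
    exact hinj d d' (hd.1.trans hd'.1.symm) (hb.1.symm.trans hb'.1)

theorem fiberSum_symm (e : α → β) (c d : α → ℝ) :
    ∑ a, fiberSum e c a * d a = ∑ a, c a * fiberSum e d a := by
  classical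
  simp only [fiberSum, Finset.sum_filter, Finset.sum_mul, Finset.mul_sum]
  rw [Finset.sum_comm]
  refine Finset.sum_congr rfl fun a _ => Finset.sum_congr rfl fun b _ => ?_
  by_cases h : e a = e b
  · simp [h]
  · simp [h, Ne.symm h]

theorem fiberSum_neg (e : α → β) (c : α → ℝ) : fiberSum e (-c) = -fiberSum e c := by
  ext a
  simp [fiberSum]

/-- If the fibres of `e` have at least three elements, then `panelOp e` does not decrease the
`ℓ²` norm, and preserves the norm only of functions with vanishing fibre sums. -/
theorem sum_sq_panelOp (e : α → β) (h3 : ∀ a, 3 ≤ {b | e b = e a}.ncard) (c : α → ℝ) :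
    ∑ a, c a ^ 2 ≤ ∑ a, panelOp e c a ^ 2 ∧
    (∑ a, panelOp e c a ^ 2 ≤ ∑ a, c a ^ 2 → fiberSum e c = 0) := by
  classical
  have hss : ∀ a, fiberSum e (fiberSum e c) a = {b | e b = e a}.ncard * fiberSum e c a := by
    intro a
    rw [fiberSum, Finset.sum_congr rfl (g := fun _ => fiberSum e c a)
      (fun b hb => fiberSum_congr e c (Finset.mem_filter.1 hb).2), Finset.sum_const, nsmul_eq_mul,
      ← Set.ncard_coe_finset]
    simp
  set k : α → ℝ := fun a => ({b | e b = e a}.ncard : ℝ) with hk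
  have hk3 : ∀ a, (3 : ℝ) ≤ k a := fun a => Nat.ofNat_le_cast.2 (h3 a)
  -- S is symmetric, and S(Sc/k) = Sc because Sc/k is constant on fibres; pairing Sc with Sc/k gives
  -- the identity.
  have hcross : ∑ a, fiberSum e c a * c a = ∑ a, fiberSum e c a ^ 2 / k a := by
    have h := fiberSum_symm e c (fun a => fiberSum e c a / k a)
    have h1 : ∀ a, fiberSum e (fun a => fiberSum e c a / k a) a = fiberSum e c a := fun a => by
      have : fiberSum e (fun a => fiberSum e c a / k a) a = fiberSum e (fiberSum e c) a / k a := by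
        rw [fiberSum, fiberSum, Finset.sum_div]
        refine Finset.sum_congr rfl fun b hb => ?_
        simp only [hk, (Finset.mem_filter.1 hb).2]
      rw [this, hss]
      have := hk3 a
      simp only [hk] at this ⊢
      field_simp
    simp only [h1] at h
    rw [Finset.sum_congr rfl fun a _ => mul_comm (fiberSum e c a) (c a), ← h]
    exact Finset.sum_congr rfl fun a _ => by ring
  have hmain : ∑ a, panelOp e c a ^ 2
      = ∑ a, c a ^ 2 + ∑ a, fiberSum e c a ^ 2 * ((k a - 2) / k a) := by
    have : ∀ a, panelOp e c a ^ 2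
        = c a ^ 2 + fiberSum e c a ^ 2 - 2 * (fiberSum e c a * c a) := fun a => by
      rw [panelOp]; ring
    simp only [this, Finset.sum_sub_distrib, Finset.sum_add_distrib, ← Finset.mul_sum, hcross]
    rw [add_sub_assoc, Finset.mul_sum, ← Finset.sum_sub_distrib]
    congr 1
    refine Finset.sum_congr rfl fun a _ => ?_
    have := hk3 a
    field_simp
  -- This strict positivity is where fibres of size two must be excluded: there P merely swaps the
  -- two points.
  have hpos : ∀ a, 0 < (k a - 2) / k a := fun a => by
    have := hk3 a
    exact div_pos (by linarith) (by linarith)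
  have hnn : ∀ a ∈ Finset.univ, 0 ≤ fiberSum e c a ^ 2 * ((k a - 2) / k a) := fun a _ =>
    mul_nonneg (sq_nonneg _) (hpos a).le
  refine ⟨by linarith [Finset.sum_nonneg hnn], fun h => ?_⟩
  have h0 := (Finset.sum_eq_zero_iff_of_nonneg hnn).1
    (le_antisymm (by linarith) (Finset.sum_nonneg hnn))
  ext a
  have h1 := (mul_eq_zero.1 (h0 a (Finset.mem_univ a))).resolve_right (hpos a).ne'
  simpa using h1

theorem panelOp_eq_neg {e : α → β} {c : α → ℝ} (h : fiberSum e c = 0) : panelOp e c = -c := by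
  ext a
  simp [panelOp, h]

/-- A fixed vector of the composition of two panel operators and a permutation is invariant under
the permutation, and has vanishing sums over the fibres. -/
theorem eq_of_panelOp_panelOp (e e' : α → β) (h3 : ∀ a, 3 ≤ {b | e b = e a}.ncard)
    (h3' : ∀ a, 3 ≤ {b | e' b = e' a}.ncard) (σ : α ≃ α) (c : α → ℝ)
    (hc : ∀ a, c a = panelOp e (panelOp e' c) (σ a)) :
    fiberSum e c = 0 ∧ fiberSum e' c = 0 ∧ ∀ a, c a = c (σ a) := by
  -- The chain ‖c‖ ≤ ‖P'c‖ ≤ ‖PP'c‖ = ‖c‖ forces equality in both estimates.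
  have h1 := sum_sq_panelOp e' h3' c
  have h2 := sum_sq_panelOp e h3 (panelOp e' c)
  have h : ∑ a, c a ^ 2 = ∑ a, panelOp e (panelOp e' c) a ^ 2 := by
    rw [← Equiv.sum_comp σ (fun a => panelOp e (panelOp e' c) a ^ 2)]
    exact Finset.sum_congr rfl fun a _ => by rw [hc a]
  have h0' := h1.2 (by linarith [h2.1])
  have h0 := h2.2 (by linarith [h1.1])
  rw [panelOp_eq_neg h0', fiberSum_neg, neg_eq_zero] at h0
  refine ⟨h0, h0', fun a => ?_⟩
  have hn : panelOp e (-c) = c := by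
    rw [panelOp_eq_neg (by rw [fiberSum_neg, h0, neg_zero]), neg_neg]
  rw [hc a, panelOp_eq_neg h0', hn]

end Panel

end A2Tilde

namespace A2Tilde

namespace Building

variable {V : Type*} {B : Building V}

/-! ### Directed chambers and their cells -/

namespace DirectedChamber

open scoped Classical in
theorem mem_swap (a : B.DirectedChamber) : {a.v₁, a.v₀, a.v₂} ∈ B.complex.faces := by
  rw [Finset.insert_comm]
  exact a.mem

open scoped Classical in
theorem mem_rotate_swap (a : B.DirectedChamber) : {a.v₂, a.v₀, a.v₁} ∈ B.complex.faces :=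
  a.rotate.rotate.mem

/-- The link of the base vertex contains no digon. -/
theorem eq_v₂_of_link {a b : B.DirectedChamber} (h₀ : a.v₀ = b.v₀) (h₁ : a.v₁ ≠ b.v₁)
    {c d : B.DirectedChamber} (hc₀ : c.v₀ = a.v₀) (hc₁ : c.v₁ = a.v₁) (hc₂ : c.v₂ = b.v₂)
    (hd₀ : d.v₀ = a.v₀) (hd₁ : d.v₁ = b.v₁) (hd₂ : d.v₂ = a.v₂) : a.v₂ = b.v₂ := by
  classical
  -- The points are the vertices `v₁` of `a` and `b`, the lines their vertices `v₂`; `c` and `d`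
  -- supply the two mixed incidences.
  refine B.isBuilding.link (v := a.v₀) (p := a.v₁) (p' := b.v₁) a.face_ne.1
    (h₀ ▸ b.face_ne.1) a.face_ne.2.2.symm (h₀ ▸ b.face_ne.2.2.symm) a.face_ne.2.1
    (hc₁ ▸ hc₂ ▸ c.face_ne.2.1) (hd₁ ▸ hd₂ ▸ d.face_ne.2.1) b.face_ne.2.1 ?_ ?_ ?_ ?_ h₁
  · convert a.mem
  · have h := c.mem
    rw [hc₀, hc₁, hc₂] at h
    exact h
  · have h := d.mem
    rw [hd₀, hd₁, hd₂] at h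
    exact h
  · convert b.mem

section Action

variable {Γ : Type*} [Group Γ] [MulAction Γ V]

theorem edge₂_toCell_eq {a b : B.DirectedChamber} (h₀ : a.v₀ = b.v₀) (h₁ : a.v₁ = b.v₁) :
    (a.toCell Γ).edge₂ = (b.toCell Γ).edge₂ :=
  congrArg (DirectedEdge.toEdge Γ) (DirectedEdge.ext h₀ h₁ : a.edge₂ = b.edge₂)

theorem edge₁_toCell_eq {a b : B.DirectedChamber} (h₀ : a.v₀ = b.v₀) (h₂ : a.v₂ = b.v₂) :
    (a.toCell Γ).edge₁ = (b.toCell Γ).edge₁ :=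
  congrArg (DirectedEdge.toEdge Γ) (DirectedEdge.ext h₂ h₀ : a.edge₁ = b.edge₁)

variable [IsA2TildeGroup Γ B]

theorem exists_smul (g : Γ) (a : B.DirectedChamber) :
    ∃ b : B.DirectedChamber, b.toCell Γ = a.toCell Γ ∧
      b.v₀ = g • a.v₀ ∧ b.v₁ = g • a.v₁ ∧ b.v₂ = g • a.v₂ := by
  classical
  obtain ⟨i, hi⟩ := IsA2TildeGroup.type_rotating (B := B) g
  refine ⟨⟨g • a.v₀, g • a.v₁, g • a.v₂, ?_, ?_, ?_⟩, ?_, rfl, rfl, rfl⟩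
  · have h := IsA2TildeGroup.image_mem (B := B) g _ a.mem
    simpa [Finset.image_insert] using h
  · rw [hi, hi, a.vtype_v₁]; ring
  · rw [hi, hi, a.vtype_v₂]; ring
  · exact Quotient.sound ((DirectedChamber.rel_iff Γ).2 ⟨g, rfl, rfl, rfl⟩)

/-- Freeness on vertices: a group element matching the two chambers fixes their common base vertex.
So around a fixed vertex the passage to the quotient identifies no chambers. -/
theorem eq_of_toCell_eq {a b : B.DirectedChamber} (h : a.toCell Γ = b.toCell Γ)
    (h₀ : a.v₀ = b.v₀) : a = b := by
  obtain ⟨g, hg₀, hg₁, hg₂⟩ := (DirectedChamber.rel_iff Γ).1 (Quotient.exact h)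
  have hg : g = 1 := IsA2TildeGroup.free B g b.v₀ (hg₀.trans h₀)
  subst hg
  simp only [one_smul] at hg₁ hg₂
  exact DirectedChamber.ext h₀ hg₁.symm hg₂.symm

/-- A cell that shares the edge `a₂` with the cell of `a` has a representative that shares the
edge `v₀ → v₁` with `a`. -/
theorem exists_lift_edge₂ {d : Cell Γ B} {a : B.DirectedChamber}
    (h : d.edge₂ = (a.toCell Γ).edge₂) :
    ∃ b : B.DirectedChamber, b.toCell Γ = d ∧ b.v₀ = a.v₀ ∧ b.v₁ = a.v₁ := by
  obtain ⟨b, rfl⟩ := Quotient.exists_rep d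
  obtain ⟨g, hg₀, hg₁⟩ := (DirectedEdge.rel_iff Γ).1 (Quotient.exact h.symm)
  obtain ⟨b', hb', h₀, h₁, -⟩ := exists_smul g b
  exact ⟨b', hb', h₀.trans hg₀, h₁.trans hg₁⟩

/-- A cell that shares the edge `a₁` with the cell of `a` has a representative that shares the
edge `v₂ → v₀` with `a`. -/
theorem exists_lift_edge₁ {d : Cell Γ B} {a : B.DirectedChamber}
    (h : d.edge₁ = (a.toCell Γ).edge₁) :
    ∃ b : B.DirectedChamber, b.toCell Γ = d ∧ b.v₀ = a.v₀ ∧ b.v₂ = a.v₂ := by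
  obtain ⟨b, rfl⟩ := Quotient.exists_rep d
  obtain ⟨g, hg₂, hg₀⟩ := (DirectedEdge.rel_iff Γ).1 (Quotient.exact h.symm)
  obtain ⟨b', hb', h₀, -, h₂⟩ := exists_smul g b
  exact ⟨b', hb', h₀.trans hg₀, h₂.trans hg₂⟩

end Action

end DirectedChamber

/-! ### Cells on an edge -/

section Cells

variable {Γ : Type*} [Group Γ] [MulAction Γ V]

theorem Cell.rotate_rotate_rotate (a : Cell Γ B) : a.rotate.rotate.rotate = a := by
  obtain ⟨a, rfl⟩ := Quotient.exists_rep a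
  rfl

/-- Cyclic permutation of directed 2-cells. -/
def rotateEquiv : Cell Γ B ≃ Cell Γ B where
  toFun := Cell.rotate
  invFun a := a.rotate.rotate
  left_inv := Cell.rotate_rotate_rotate
  right_inv := Cell.rotate_rotate_rotate

variable [IsA2TildeGroup Γ B]

/-- Each edge of a directed 2-cell is contained in at least three cells. -/
theorem three_le_ncard_edge₂ (a : Cell Γ B) :
    3 ≤ {b : Cell Γ B | b.edge₂ = a.edge₂}.ncard := by
  classical
  obtain ⟨a, rfl⟩ := Quotient.exists_rep a
  have := finite_cell Γ B
  have hmem : ({a.v₀, a.v₁} : Finset V) ∈ B.complex.faces := by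
    exact a.edge₂.mem
  -- The chambers on the edge, based at `a.v₀`, inject into the cells by `eq_of_toCell_eq`, so
  -- thickness passes to the quotient.
  refine (B.thick _ hmem (Finset.card_pair a.face_ne.1)).trans ?_
  have hex : ∀ s : Finset V, s ∈ {s | s ∈ B.complex.faces ∧ s.card = 3 ∧ {a.v₀, a.v₁} ⊆ s} →
      ∃ b : B.DirectedChamber, b.v₀ = a.v₀ ∧ b.v₁ = a.v₁ ∧ ({b.v₀, b.v₁, b.v₂} : Finset V) = s := by
    rintro s ⟨hs, hc, he⟩
    obtain ⟨b, ⟨hb₀, hb⟩, -⟩ := B.existsUnique_directedChamber s hs hc a.v₀ (he (by simp))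
    have hb : ({b.v₀, b.v₁, b.v₂} : Finset V) = s := by convert hb
    refine ⟨b, hb₀, ?_, hb⟩
    refine (B.existsUnique_vtype s hs hc (B.vtype a.v₀ + 1)).unique ⟨?_, ?_⟩ ⟨he (by simp), a.vtype_v₁⟩
    · rw [← hb]; simp
    · rw [b.vtype_v₁, hb₀]
  have : Nonempty B.DirectedChamber := ⟨a⟩
  choose! F hF₀ hF₁ hF using hex
  refine Set.ncard_le_ncard_of_injOn (fun s => (F s).toCell Γ) (fun s hs => ?_) ?_ (Set.toFinite _)
  · exact DirectedChamber.edge₂_toCell_eq (hF₀ s hs) (hF₁ s hs)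
  · intro s hs t ht hst
    have h := DirectedChamber.eq_of_toCell_eq hst ((hF₀ s hs).trans (hF₀ t ht).symm)
    rw [← hF s hs, ← hF t ht, h]

/-- Rotation turns the edge `a₂` of a cell into the edge `a₁` of the rotated cell. -/
theorem three_le_ncard_edge₁ (a : Cell Γ B) :
    3 ≤ {b : Cell Γ B | b.edge₁ = a.edge₁}.ncard := by
  have := finite_cell Γ B
  refine (three_le_ncard_edge₂ a.rotate.rotate).trans ?_
  refine Set.ncard_le_ncard_of_injOn Cell.rotate (fun b hb => ?_)
    (rotateEquiv.injective.injOn) (Set.toFinite _)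
  change b.rotate.rotate.edge₀ = _
  refine (hb : b.edge₂ = _).trans ?_
  change a.rotate.rotate.rotate.rotate.edge₀ = a.rotate.edge₀
  rw [Cell.rotate_rotate_rotate]

/-! ### The transition matrices as products of panel operators -/

/-- `RelM a b` if and only if `b` is reached from `a.rotate` by changing first the third and then
the second vertex. -/
theorem relM_iff {a b : Cell Γ B} : RelM a b ↔ ∃ d : Cell Γ B,
    (d.edge₂ = a.rotate.edge₂ ∧ d ≠ a.rotate) ∧ b.edge₁ = d.edge₁ ∧ b ≠ d := by
  classical
  constructor
  · rintro ⟨α, β, rfl, rfl, h₀, hf, hn⟩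
    have hf : ({α.v₁, α.v₂, β.v₂} : Finset V) ∈ B.complex.faces := by convert hf
    have hn : ({α.v₁, α.v₀, β.v₁} : Finset V) ∉ B.complex.faces := by convert hn
    -- The intermediate chamber. If either step were trivial, the forbidden simplex would be a
    -- chamber: that of `β` in the first case, that of `α` in the second.
    let δ : B.DirectedChamber := ⟨α.v₁, α.v₂, β.v₂, by convert hf, α.rotate.vtype_v₁,
      by rw [β.vtype_v₂, h₀]⟩
    refine ⟨δ.toCell Γ, ⟨DirectedChamber.edge₂_toCell_eq (b := α.rotate) rfl rfl, fun h => hn ?_⟩,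
      DirectedChamber.edge₁_toCell_eq h₀ rfl, fun h => hn ?_⟩
    · have h := DirectedChamber.eq_of_toCell_eq (b := α.rotate) h rfl
      have h2 : β.v₂ = α.v₀ := congrArg DirectedChamber.v₂ h
      have := β.mem_rotate_swap
      rw [h2, h₀, Finset.insert_comm] at this
      convert this
    · have h := DirectedChamber.eq_of_toCell_eq h h₀
      rw [h]
      convert α.mem_swap
  · rintro ⟨d, ⟨hd, hda⟩, hb, hbd⟩
    obtain ⟨α, rfl⟩ := Quotient.exists_rep a
    obtain ⟨δ, rfl, hδ₀, hδ₁⟩ := DirectedChamber.exists_lift_edge₂ (a := α.rotate) hd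
    obtain ⟨β, rfl, hβ₀, hβ₂⟩ := DirectedChamber.exists_lift_edge₁ hb
    refine ⟨α, β, rfl, rfl, hβ₀.trans hδ₀, ?_, fun hm => hbd ?_⟩
    · have h := δ.mem
      rw [hδ₀, hδ₁, ← hβ₂] at h
      exact h
    have hm : ({α.v₁, α.v₀, β.v₁} : Finset V) ∈ B.complex.faces := by convert hm
    -- Were `ε` a chamber, the points `α.v₂`, `β.v₁` would both lie on the lines `α.v₀`, `β.v₂`.
    -- Without digons the points or the lines coincide, making the second or the first step trivial.
    let ε : B.DirectedChamber := ⟨β.v₀, β.v₁, α.v₀,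
      by rw [Finset.pair_comm, hβ₀, hδ₀]; exact hm, β.vtype_v₁,
      by rw [hβ₀, hδ₀]; exact α.rotate.vtype_v₂⟩
    by_contra hne
    have h₁ : α.v₂ ≠ β.v₁ := fun h => hne <| congrArg (DirectedChamber.toCell Γ) <|
      DirectedChamber.ext hβ₀ (h.symm.trans hδ₁.symm) hβ₂
    have h₂ : α.v₀ = β.v₂ := DirectedChamber.eq_v₂_of_link (a := α.rotate) (b := β)
      (c := δ) (d := ε) (hβ₀.trans hδ₀).symm h₁ hδ₀ hδ₁ hβ₂.symm (hβ₀.trans hδ₀) rfl rfl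
    exact hda <| congrArg (DirectedChamber.toCell Γ) <|
      DirectedChamber.ext (y := α.rotate) hδ₀ hδ₁ (hβ₂.symm.trans h₂.symm)

/-- `RelN a c` if and only if `c` is reached from `a.rotate.rotate` by changing first the second
and then the third vertex. -/
theorem relN_iff {a c : Cell Γ B} : RelN a c ↔ ∃ d : Cell Γ B,
    (d.edge₁ = a.rotate.rotate.edge₁ ∧ d ≠ a.rotate.rotate) ∧ c.edge₂ = d.edge₂ ∧ c ≠ d := by
  classical
  constructor
  · rintro ⟨α, γ, rfl, rfl, h₀, hf, hn⟩
    have hf : ({α.v₂, α.v₁, γ.v₁} : Finset V) ∈ B.complex.faces := by convert hf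
    have hn : ({α.v₂, α.v₀, γ.v₂} : Finset V) ∉ B.complex.faces := by convert hn
    let δ : B.DirectedChamber := ⟨α.v₂, γ.v₁, α.v₁, by rw [Finset.pair_comm]; convert hf,
      by rw [γ.vtype_v₁, h₀], α.rotate.rotate.vtype_v₂⟩
    refine ⟨δ.toCell Γ,
      ⟨DirectedChamber.edge₁_toCell_eq (b := α.rotate.rotate) rfl rfl, fun h => hn ?_⟩,
      DirectedChamber.edge₂_toCell_eq h₀ rfl, fun h => hn ?_⟩
    · have h := DirectedChamber.eq_of_toCell_eq (b := α.rotate.rotate) h rfl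
      have h1 : γ.v₁ = α.v₀ := congrArg DirectedChamber.v₁ h
      have := γ.mem
      rw [h1, h₀] at this
      convert this
    · have h := DirectedChamber.eq_of_toCell_eq h h₀
      rw [h]
      convert α.mem_rotate_swap
  · rintro ⟨d, ⟨hd, hda⟩, hc, hcd⟩
    obtain ⟨α, rfl⟩ := Quotient.exists_rep a
    obtain ⟨δ, rfl, hδ₀, hδ₂⟩ := DirectedChamber.exists_lift_edge₁ (a := α.rotate.rotate) hd
    obtain ⟨γ, rfl, hγ₀, hγ₁⟩ := DirectedChamber.exists_lift_edge₂ hc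
    refine ⟨α, γ, rfl, rfl, hγ₀.trans hδ₀, ?_, fun hm => hcd ?_⟩
    · have h := δ.mem
      rw [hδ₀, hδ₂, ← hγ₁, Finset.pair_comm] at h
      exact h
    have hm : ({α.v₂, α.v₀, γ.v₂} : Finset V) ∈ B.complex.faces := by convert hm
    -- The dual digon: points `α.v₀`, `γ.v₁` on lines `α.v₁`, `γ.v₂`. Equal points make the first
    -- step trivial, equal lines the second.
    let ε : B.DirectedChamber := ⟨γ.v₀, α.v₀, γ.v₂, by rw [hγ₀, hδ₀]; exact hm,
      by rw [hγ₀, hδ₀]; exact α.rotate.rotate.vtype_v₁, γ.vtype_v₂⟩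
    by_contra hne
    have h₁ : α.v₀ ≠ γ.v₁ := fun h => hda <| congrArg (DirectedChamber.toCell Γ) <|
      DirectedChamber.ext (y := α.rotate.rotate) hδ₀ (hγ₁.symm.trans h.symm) hδ₂
    have h₂ : α.v₁ = γ.v₂ := DirectedChamber.eq_v₂_of_link (a := α.rotate.rotate) (b := γ)
      (c := ε) (d := δ) (hγ₀.trans hδ₀).symm h₁ (hγ₀.trans hδ₀) rfl rfl hδ₀ hγ₁.symm hδ₂
    exact hne <| congrArg (DirectedChamber.toCell Γ) <|
      DirectedChamber.ext hγ₀ hγ₁ (h₂.symm.trans hδ₂.symm)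

/-- A directed 2-cell is determined by the two labels at its base vertex. -/
theorem Cell.ext_edge {a b : Cell Γ B} (h₁ : a.edge₁ = b.edge₁) (h₂ : a.edge₂ = b.edge₂) :
    a = b := by
  obtain ⟨β, rfl⟩ := Quotient.exists_rep b
  obtain ⟨α, rfl, hα₀, hα₁⟩ := DirectedChamber.exists_lift_edge₂ h₂
  obtain ⟨α', h, hα'₀, hα'₂⟩ := DirectedChamber.exists_lift_edge₁ h₁
  -- The two lifts of the same cell share a base vertex, hence are one chamber, agreeing with `β` in
  -- all three vertices.
  obtain rfl := DirectedChamber.eq_of_toCell_eq h (hα'₀.trans hα₀.symm)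
  exact congrArg (DirectedChamber.toCell Γ) (DirectedChamber.ext hα₀ hα₁ hα'₂)

/-- By `Cell.ext_edge` the intermediate cell in `relM_iff` is unique, so the product of the panel
operators has entries 0 and 1 only. -/
theorem sum_matM_mul (c : Cell Γ B → ℝ) (a : Cell Γ B) :
    ∑ b, (matM Γ B a b : ℝ) * c b = panelOp Cell.edge₂ (panelOp Cell.edge₁ c) a.rotate := by
  classical
  rw [panelOp_panelOp_eq_sum _ _ (fun d d' h h' => Cell.ext_edge h' h), Finset.sum_filter]
  refine Finset.sum_congr rfl fun b _ => ?_
  simp only [matM, Matrix.of_apply, ← relM_iff]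
  split_ifs <;> simp

theorem sum_matN_mul (c : Cell Γ B → ℝ) (a : Cell Γ B) :
    ∑ b, (matN Γ B a b : ℝ) * c b
      = panelOp Cell.edge₁ (panelOp Cell.edge₂ c) a.rotate.rotate := by
  classical
  rw [panelOp_panelOp_eq_sum _ _ (fun d d' h h' => Cell.ext_edge h h'), Finset.sum_filter]
  refine Finset.sum_congr rfl fun b _ => ?_
  simp only [matN, Matrix.of_apply, ← relN_iff]
  split_ifs <;> simp

/-! ### Harmonic cochains as fixed vectors -/

/-- Sums indexed by edges become fibre sums through cells; an edge that is not a label of any cell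
contributes an empty sum. -/
theorem mem_harmonicCochains_iff {c : Cell Γ B → ℝ} : c ∈ harmonicCochains Γ B ↔
    (∀ a, c a = c a.rotate) ∧ fiberSum Cell.edge₁ c = 0 ∧ fiberSum Cell.edge₂ c = 0 := by
  classical
  constructor
  · rintro ⟨h, h'⟩
    refine ⟨fun a => (h a).1, ?_, ?_⟩
    · ext a
      exact (h' a.edge₁).2
    · ext a
      exact (h' a.edge₂).1
  · rintro ⟨h, h₁, h₂⟩
    refine ⟨fun a => ⟨h a, (h a).trans (h _)⟩, fun ξ => ⟨?_, ?_⟩⟩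
    · by_cases hξ : ∃ a : Cell Γ B, a.edge₂ = ξ
      · obtain ⟨a, rfl⟩ := hξ
        exact congrFun h₂ a
      · exact Finset.sum_eq_zero fun a ha => (hξ ⟨a, (Finset.mem_filter.1 ha).2⟩).elim
    · by_cases hξ : ∃ a : Cell Γ B, a.edge₁ = ξ
      · obtain ⟨a, rfl⟩ := hξ
        exact congrFun h₁ a
      · exact Finset.sum_eq_zero fun a ha => (hξ ⟨a, (Finset.mem_filter.1 ha).2⟩).elim

/-- Harmonic cochains are the common fixed vectors of the transition matrices. -/
theorem mem_harmonicCochains_iff_fixed {c : Cell Γ B → ℝ} : c ∈ harmonicCochains Γ B ↔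
    ∀ a, c a = ∑ b, (matM Γ B a b : ℝ) * c b ∧ c a = ∑ b, (matN Γ B a b : ℝ) * c b := by
  simp only [sum_matM_mul, sum_matN_mul, mem_harmonicCochains_iff]
  constructor
  · rintro ⟨h, h₁, h₂⟩ a
    have hneg : ∀ e : Cell Γ B → Edge Γ B, fiberSum e c = 0 → panelOp e (-c) = c := fun e he => by
      rw [panelOp_eq_neg (by rw [fiberSum_neg, he, neg_zero]), neg_neg]
    rw [panelOp_eq_neg h₁, panelOp_eq_neg h₂, hneg _ h₁, hneg _ h₂]
    exact ⟨h a, (h a).trans (h _)⟩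
  · intro h
    obtain ⟨h₂, h₁, hr⟩ := eq_of_panelOp_panelOp Cell.edge₂ Cell.edge₁ three_le_ncard_edge₂
      three_le_ncard_edge₁ rotateEquiv c fun a => (h a).1
    exact ⟨hr, h₁, h₂⟩

/-! ### Duality with ℝ ⊗ C(Γ) -/

variable (Γ B) in
/-- A real linear form on `ℝ ⊗ C(Γ)`, as a function on the generators of `C(Γ)`. -/
noncomputable def evalGenerators :
    Module.Dual ℝ (ℝ ⊗[ℤ] CGroup Γ B) →ₗ[ℝ] (Cell Γ B → ℝ) where
  toFun φ a := φ (1 ⊗ₜ[ℤ] QuotientAddGroup.mk (Finsupp.single a 1))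
  map_add' _ _ := rfl
  map_smul' _ _ := rfl

variable (Γ B) in
/-- The homomorphism `f ↦ 1 ⊗ [f]` from the free abelian group on the directed 2-cells. -/
noncomputable def toTensor : (Cell Γ B →₀ ℤ) →+ ℝ ⊗[ℤ] CGroup Γ B :=
  (TensorProduct.mk ℤ ℝ (CGroup Γ B) 1).toAddMonoidHom.comp (QuotientAddGroup.mk' (relators Γ B))

/-- Since x ⊗ y = x • (1 ⊗ y), a real linear form is determined by the tensors 1 ⊗ y, and by
additivity by those with y a generator. -/
theorem evalGenerators_injective : Function.Injective (evalGenerators B Γ) := by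
  intro φ ψ h
  have hcomp : φ.toAddMonoidHom.comp (toTensor B Γ) = ψ.toAddMonoidHom.comp (toTensor B Γ) :=
    Finsupp.addHom_ext' fun a => AddMonoidHom.ext_int (congrFun h a)
  refine TensorProduct.AlgebraTensorModule.ext fun x y => ?_
  obtain ⟨f, rfl⟩ := QuotientAddGroup.mk_surjective y
  have hf : φ (1 ⊗ₜ[ℤ] QuotientAddGroup.mk f) = ψ (1 ⊗ₜ[ℤ] QuotientAddGroup.mk f) :=
    DFunLike.congr_fun hcomp f
  rw [← mul_one x, ← smul_eq_mul, ← TensorProduct.smul_tmul', map_smul, map_smul, hf]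

/-- A function on the generators comes from a linear form exactly when its additive extension `F`
kills the relators, which are the fixed vector equations for M and N. -/
theorem range_evalGenerators : LinearMap.range (evalGenerators B Γ) = harmonicCochains Γ B := by
  ext c
  rw [mem_harmonicCochains_iff_fixed]
  let F : (Cell Γ B →₀ ℤ) →+ ℝ := (Finsupp.linearCombination ℤ c).toAddMonoidHom
  have hF : ∀ (A : Matrix (Cell Γ B) (Cell Γ B) ℤ) (a : Cell Γ B),
      F (Finsupp.single a 1 - ∑ b, A a b • Finsupp.single b (1 : ℤ))
        = c a - ∑ b, (A a b : ℝ) * c b := fun A a => by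
    simp [F]
  constructor
  · rintro ⟨φ, hφ⟩ a
    have hFφ : F = φ.toAddMonoidHom.comp (toTensor B Γ) := by
      refine Finsupp.addHom_ext' fun a => AddMonoidHom.ext_int ?_
      have : c a = φ (toTensor B Γ (Finsupp.single a 1)) := (congrFun hφ a).symm
      simpa [F] using this
    have hrel : ∀ r ∈ relators Γ B, F r = 0 := fun r hr => by
      have h0 : (QuotientAddGroup.mk r : CGroup Γ B) = 0 := (QuotientAddGroup.eq_zero_iff r).2 hr
      have h1 : toTensor B Γ r = (1 : ℝ) ⊗ₜ[ℤ] (QuotientAddGroup.mk r : CGroup Γ B) := rfl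
      rw [hFφ, AddMonoidHom.comp_apply, h1, h0, TensorProduct.tmul_zero, map_zero]
    exact ⟨sub_eq_zero.1 ((hF _ a).symm.trans
        (hrel _ (AddSubgroup.subset_closure (Or.inl ⟨a, rfl⟩)))),
      sub_eq_zero.1 ((hF _ a).symm.trans
        (hrel _ (AddSubgroup.subset_closure (Or.inr ⟨a, rfl⟩))))⟩
  · intro h
    have hker : relators Γ B ≤ F.ker := by
      refine (AddSubgroup.closure_le _).2 (Set.union_subset ?_ ?_)
      · rintro _ ⟨a, rfl⟩
        exact (hF _ a).trans (sub_eq_zero.2 (h a).1)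
      · rintro _ ⟨a, rfl⟩
        exact (hF _ a).trans (sub_eq_zero.2 (h a).2)
    let G : CGroup Γ B →+ ℝ := QuotientAddGroup.lift _ F hker
    -- The linear form is x ⊗ y ↦ x · G(y).
    refine ⟨TensorProduct.AlgebraTensorModule.lift
      ((LinearMap.toSpanSingleton ℝ (CGroup Γ B →ₗ[ℤ] ℝ) G.toIntLinearMap)), ?_⟩
    ext a
    simp [evalGenerators, G, F]

/-- This makes ℝ ⊗ C(Γ) finite dimensional, as needed for comparing it with its dual. -/
instance : Module.Finite ℤ (CGroup Γ B) :=
  Module.Finite.of_surjective (QuotientAddGroup.mk' (relators Γ B)).toIntLinearMap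
    (QuotientAddGroup.mk'_surjective _)

variable (Γ B) in
theorem nonempty_harmonicCochains_linearEquiv :
    Nonempty (harmonicCochains Γ B ≃ₗ[ℝ] (ℝ ⊗[ℤ] CGroup Γ B)) := by
  have e := (LinearEquiv.ofInjective _ (evalGenerators_injective (B := B) (Γ := Γ))).trans
    (LinearEquiv.ofEq _ _ range_evalGenerators)
  exact ⟨e.symm.trans (LinearEquiv.ofFinrankEq _ _ Subspace.dual_finrank_eq)⟩

end Cells
end Building

end A2Tilde

theorem proposition4p1 {V : Type*} (B : A2Tilde.Building V)
    (Γ : Type*) [Group Γ] [MulAction Γ V] [A2Tilde.IsA2TildeGroup Γ B]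
    (torsionFree : ∀ g : Γ, IsOfFinOrder g → g = 1) :
    Nonempty (A2Tilde.Building.harmonicCochains Γ B ≃ₗ[ℝ]
      (ℝ ⊗[ℤ] A2Tilde.Building.CGroup Γ B)) :=
  A2Tilde.Building.nonempty_harmonicCochains_linearEquiv B Γ
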